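/- For a finite-dimensional complex Lie algebra $\mathfrak g$ and $f\in\mathfrak g^{*}$ put $\mathfrak g_f=\{x\in\mathfrak g : f([x,y])=0 \text{ for all } y\in\mathfrak g\}$, and let the index of $\mathfrak g$ be $\chi[\mathfrak g]=\min\{\dim\mathfrak g_f : f\in\mathfrak g^{*}\}$. For a composition $(a_1,\dots,a_k)$ of $n$ into positive integers let $\mathfrak p(a_1,\dots,a_k)\subseteq\mathfrak{gl}(n,\mathbb C)$ denote the parabolic subalgebra, unique up to conjugation by $GL(n,\mathbb C)$, of block upper triangular matrices with diagonal blocks of sizes $a_1,\dots,a_k$ in this order. Then for all positive integers $a_1,a_2,a_3$: 1. $\chi[\mathfrak p(a_1,a_2)]=\gcd(a_1,a_2)$; 2. $\chi[\mathfrak p(a_1,a_2,a_3)]=\gcd(a_1+a_2,\;a_2+a_3)$. -/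

import Mathlib

/- Matrices over a field form a Lie algebra for the commutator bracket `⁅M, N⁆ = M * N - N * M`. -/
attribute [local instance 100] LieRing.ofAssociativeRing

/-- The stabiliser `{x ∈ L | f ⁅x, y⁆ = 0 for all y ∈ L}` of a linear form `f` on a Lie algebra `L`
for the coadjoint action. -/
def coadjointStabilizer {K L : Type*} [Field K] [LieRing L] [LieAlgebra K L]
    (f : Module.Dual K L) : Submodule K L where
  carrier := {x | ∀ y : L, f ⁅x, y⁆ = 0}
  zero_mem' := by intro y; simp
  add_mem' := by
    intro x x' hx hx' y
    simp only [Set.mem_ofPred_eq] at hx hx'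
    simp [add_lie, hx y, hx' y]
  smul_mem' := by
    intro t x hx y
    simp only [Set.mem_ofPred_eq] at hx
    simp [smul_lie, hx y]

/-- The index of a (finite-dimensional) Lie algebra: the smallest dimension of the stabiliser of a
linear form. -/
noncomputable def lieIndex (K L : Type*) [Field K] [LieRing L] [LieAlgebra K L] : ℕ :=
  sInf (Set.range fun f : Module.Dual K L => Module.finrank K (coadjointStabilizer f))

/-- The standard parabolic subalgebra of `𝔤𝔩(n)` attached to a composition `c = (a₁, …, a_k)` of `n`:
the block upper triangular matrices with diagonal blocks of sizes `a₁, …, a_k` in this order,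
`c.index i` being the number of the block that contains `i`. -/
def standardParabolic {n : ℕ} (c : Composition n) :
    LieSubalgebra ℂ (Matrix (Fin n) (Fin n) ℂ) where
  carrier := {M | M.BlockTriangular c.index}
  zero_mem' := Matrix.blockTriangular_zero
  add_mem' := fun hM hN => hM.add hN
  smul_mem' := fun t M hM i j hij => by simp [hM hij]
  lie_mem' := by
    intro M N hM hN
    rw [Ring.lie_def]
    exact (hM.mul hN).sub (hN.mul hM)

/-- `𝔭` is a parabolic subalgebra `𝔭(a₁, …, a_k)` of `𝔤𝔩(n)`, where `c = (a₁, …, a_k)`: it is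
conjugate under `GL(n)` to the standard one. -/
def IsParabolicOfType {n : ℕ} (c : Composition n)
    (𝔭 : LieSubalgebra ℂ (Matrix (Fin n) (Fin n) ℂ)) : Prop :=
  ∃ g : Matrix.GeneralLinearGroup (Fin n) ℂ, ∀ M : Matrix (Fin n) (Fin n) ℂ,
    M ∈ 𝔭 ↔ (g⁻¹).val * M * g.val ∈ standardParabolic c

/-! A form on the block triangular algebra is `x ↦ tr (F x)`. The proof produces one whose
stabiliser is a torus of the required dimension, and shows that such a stabiliser computes the
index.

Construction: a generic radical component of `F` is put in normal form, a partial identity of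
maximal rank. Its stabiliser is a smaller algebra of the same kind, once the three-block chains are
enlarged by the "fork" algebras (one least block below two incomparable ones). Reductions
`of_removeInjective` and `of_removeSurjective` lift a torus form from the smaller algebra. On block
sizes they are subtractions preserving gcd(a+b, b+c) for chains and gcd(i, p+q) for forks, so
Euclid's algorithm ends at reductive algebras (`chainForm_and_forkForm_gcd`).

Minimality: let `Y` be the matrices whose associated form is invariant under the torus. The tangent
directions of the orbit of `F`, together with `Y`, fill the matrix space, so every form near that of
`F` is conjugate to one from `F + Y` and its stabiliser contains a conjugate torus. Stabiliser
dimension cannot rise along a generic perturbation `f + t F`, which after rescaling is close to `F`;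
hence no form has a smaller stabiliser (`lieIndex_standardParabolic_of_hasDiagonalForm`). -/

/-- The form `x ↦ tr (F x)` on the space of matrices supported on `R` is represented by a matrix `F`
supported on the transposed relation, and its stabiliser consists of the diagonal matrices with
entries constant on the fibres of a surjection onto `Fin d`. -/
def HasDiagonalForm {ι : Type} [Fintype ι] [DecidableEq ι] (R : ι → ι → Prop) (d : ℕ) : Prop :=
  ∃ (F : Matrix ι ι ℂ) (π : ι → Fin d), Function.Surjective π ∧
    (∀ i j, F i j ≠ 0 → R j i ∧ π i = π j) ∧
    ∀ x : Matrix ι ι ℂ, (∀ i j, ¬ R i j → x i j = 0) →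
      (∀ i j, R j i → (x * F) i j = (F * x) i j) → ∃ v : Fin d → ℂ, x = Matrix.diagonal (v ∘ π)

/-! ### Torus stabilisers: base case and reductions. -/

namespace HasDiagonalForm

/-- Lets the reductions, stated for a block with no incoming relations, be applied to a block with
no outgoing ones. -/
theorem transpose {ι : Type} [Fintype ι] [DecidableEq ι] {R : ι → ι → Prop} {d : ℕ}
    (h : HasDiagonalForm R d) : HasDiagonalForm (fun i j => R j i) d := by
  obtain ⟨F, π, hπ, hF, hx⟩ := h
  refine ⟨F.transpose, π, hπ, fun i j hij => ⟨(hF j i hij).1, (hF j i hij).2.symm⟩, ?_⟩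
  intro x hs he
  obtain ⟨v, hv⟩ := hx x.transpose (fun i j hij => hs j i hij) (fun i j hij => by
    have := he j i hij
    rw [← Matrix.transpose_apply (x * _), ← Matrix.transpose_apply (_ * x), Matrix.transpose_mul,
      Matrix.transpose_mul, Matrix.transpose_transpose] at this
    exact this.symm)
  refine ⟨v, ?_⟩
  rw [← Matrix.transpose_transpose x, hv, Matrix.diagonal_transpose]

theorem reindex {ι ι' : Type} [Fintype ι] [DecidableEq ι] [Fintype ι'] [DecidableEq ι']
    {R : ι → ι → Prop} {R' : ι' → ι' → Prop} {d : ℕ} (e : ι' ≃ ι)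
    (hR : ∀ i j, R' i j ↔ R (e i) (e j)) (h : HasDiagonalForm R d) : HasDiagonalForm R' d := by
  obtain ⟨F, π, hπ, hF, hx⟩ := h
  refine ⟨F.submatrix e e, π ∘ e, hπ.comp e.surjective,
    fun i j hij => ⟨(hR _ _).2 (hF _ _ hij).1, (hF _ _ hij).2⟩, ?_⟩
  intro x hs he
  obtain ⟨v, hv⟩ := hx (x.submatrix e.symm e.symm)
    (fun i j hij => hs _ _ (by simpa [hR] using hij)) (fun i j hij => by
      have := he (e.symm i) (e.symm j) (by simpa [hR] using hij)
      simp only [Matrix.mul_apply, Matrix.submatrix_apply] at this ⊢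
      rw [← e.sum_comp, ← e.sum_comp (fun k => F i k * _)]
      simpa using this)
  refine ⟨v, ?_⟩
  ext i j
  have := congrFun (congrFun hv (e i)) (e j)
  simpa [Matrix.diagonal_apply] using this

/-- A diagonal matrix with distinct entries is regular semisimple: only diagonal matrices commute
with it. -/
theorem of_symmetric {ι : Type} [Fintype ι] [DecidableEq ι] {R : ι → ι → Prop}
    (hr : ∀ i, R i i) (hs : ∀ i j, R i j → R j i) : HasDiagonalForm R (Fintype.card ι) := by
  let π := Fintype.equivFin ι
  refine ⟨Matrix.diagonal fun i => ((π i : ℕ) : ℂ), π, π.surjective, fun i j hij => ?_, ?_⟩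
  · have : i = j := by
      by_contra h
      exact hij (Matrix.diagonal_apply_ne _ h)
    subst this
    exact ⟨hr i, rfl⟩
  · intro x hx he
    refine ⟨fun k => x (π.symm k) (π.symm k), ?_⟩
    ext i j
    by_cases hij : i = j
    · subst hij; simp
    rw [Matrix.diagonal_apply_ne _ hij]
    by_cases hR : R i j
    · have := he i j (hs _ _ hR)
      rw [Matrix.mul_diagonal, Matrix.diagonal_mul, mul_comm, ← sub_eq_zero, ← sub_mul] at this
      refine (mul_eq_zero.1 this).resolve_left fun h0 => hij ?_
      rw [sub_eq_zero] at h0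
      exact (π.injective (Fin.ext (by exact_mod_cast h0))).symm
    · exact hx i j hR

/-- Fix the standard injection of `α` into `α ⊕ γ` as the radical component. What stabilises it
preserves its image, so the entries of type (γ, α) vanish, and its action on the first copy of `α`
is determined by that on the second. The algebra of `S` remains. -/
theorem of_removeInjective {α γ δ : Type} [Fintype α] [DecidableEq α] [Fintype γ] [DecidableEq γ]
    [Fintype δ] [DecidableEq δ] {S : (α ⊕ γ) ⊕ δ → (α ⊕ γ) ⊕ δ → Prop} {d : ℕ}
    {R : α ⊕ ((α ⊕ γ) ⊕ δ) → α ⊕ ((α ⊕ γ) ⊕ δ) → Prop}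
    (h₁ : ∀ i j, R (.inl i) (.inl j)) (h₂ : ∀ i j, R (.inl i) (.inr (.inl j)))
    (h₃ : ∀ i j, ¬ R (.inl i) (.inr (.inr j))) (h₄ : ∀ i j, ¬ R (.inr i) (.inl j))
    (h₅ : ∀ g k, R (.inr (.inl (.inr g))) (.inr (.inl (.inl k))))
    (h₆ : ∀ g k, ¬ S (.inl (.inr g)) (.inl (.inl k)))
    (h₇ : ∀ i j, (∀ g k, i = .inl (.inr g) → j ≠ .inl (.inl k)) →
      (R (.inr i) (.inr j) ↔ S i j))
    (h : HasDiagonalForm S d) : HasDiagonalForm R d := by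
  obtain ⟨D, π, hπ, hD, hx⟩ := h
  have h₈ : ∀ i j, S i j → R (.inr i) (.inr j) := fun i j hij =>
    (h₇ i j (by rintro g k rfl rfl; exact h₆ _ _ hij)).2 hij
  let C : Matrix ((α ⊕ γ) ⊕ δ) α ℂ :=
    Matrix.of (Sum.elim (Sum.elim (fun k j => if k = j then 1 else 0) fun _ _ => 0) fun _ _ => 0)
  have C₁ : ∀ k j, C (.inl (.inl k)) j = if k = j then 1 else 0 := fun _ _ => rfl
  have C₂ : ∀ k j, C (.inl (.inr k)) j = 0 := fun _ _ => rfl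
  have C₃ : ∀ k j, C (.inr k) j = 0 := fun _ _ => rfl
  let π' : α ⊕ ((α ⊕ γ) ⊕ δ) → Fin d := Sum.elim (fun k => π (.inl (.inl k))) π
  -- Both copies of an index of `α` get the same torus weight, as `C` identifies them.
  refine ⟨Matrix.fromBlocks 0 0 C D, π', fun k => ?_, ?_, ?_⟩
  · obtain ⟨a, ha⟩ := hπ k
    exact ⟨.inr a, ha⟩
  · rintro (i | (i | i) | i) (j | j) hij
    all_goals try simp [C₁, C₂, C₃] at hij
    · subst hij; exact ⟨h₂ _ _, rfl⟩
    all_goals exact ⟨h₈ _ _ (hD _ _ hij).1, (hD _ _ hij).2⟩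
  · intro x hs he
    have s₁ : ∀ i j, x (.inr i) (.inl j) = 0 := fun i j => hs _ _ (h₄ i j)
    have s₂ : ∀ i j, x (.inl i) (.inr (.inr j)) = 0 := fun i j => hs _ _ (h₃ i j)
    have y₀ : ∀ i j, x (.inl i) (.inr (.inl (.inl j))) = 0 := fun i j => by
      simpa [Matrix.mul_apply, C₁, C₂, C₃] using he (.inl i) (.inl j) (h₁ _ _)
    have z₀ : ∀ g j, x (.inr (.inl (.inr g))) (.inr (.inl (.inl j))) = 0 := fun g j => by
      simpa [Matrix.mul_apply, C₁, C₂, C₃, s₁] using he (.inr (.inl (.inr g))) (.inl j) (h₂ _ _)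
    have z₁ : ∀ i j, x (.inr (.inl (.inl i))) (.inr (.inl (.inl j))) = x (.inl i) (.inl j) :=
      fun i j => by
        simpa [Matrix.mul_apply, C₁, C₂, C₃, s₁] using he (.inr (.inl (.inl i))) (.inl j) (h₂ _ _)
    have key : ∀ a b, R (.inr b) (.inr a) → (x.toBlocks₂₂ * D) a b =
        ∑ k, C a k * x (.inl k) (.inr b) + (D * x.toBlocks₂₂) a b := fun a b hab => by
      have := he (.inr a) (.inr b) hab
      simp only [Matrix.mul_apply, Fintype.sum_sum_type (α₁ := α), Matrix.fromBlocks_apply₁₂,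
        Matrix.fromBlocks_apply₂₂, Matrix.fromBlocks_apply₂₁, Matrix.zero_apply, mul_zero,
        Finset.sum_const_zero, zero_add] at this
      simpa only [Matrix.mul_apply, Matrix.toBlocks₂₂, Matrix.of_apply] using this
    obtain ⟨v, hv⟩ := hx x.toBlocks₂₂ (fun i j hij => by
        by_cases hh : ∃ g k, i = .inl (.inr g) ∧ j = .inl (.inl k)
        · obtain ⟨g, k, rfl, rfl⟩ := hh
          exact z₀ g k
        · exact hs _ _ (by rwa [h₇ i j (fun g k hi hj => hh ⟨g, k, hi, hj⟩)]))
      (fun a b hab => by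
        rw [key a b (h₈ _ _ hab), add_eq_right]
        rcases a with (a | a) | a
        · rcases b with (b | b) | b
          · simp [y₀]
          · exact absurd hab (h₆ _ _)
          · simp [s₂]
        · simp [C₂]
        · simp [C₃])
    have z : ∀ a b, x (.inr a) (.inr b) = Matrix.diagonal (v ∘ π) a b :=
      fun a b => congrFun (congrFun hv a) b
    refine ⟨v, ?_⟩
    ext i j
    rcases i with i | i
    · rcases j with j | (j | j) | j
      · rw [← z₁, z, Matrix.diagonal_apply, Matrix.diagonal_apply]
        simp [π']
      · simpa using y₀ i j
      -- With the lower block of `x` already diagonal and this entry of `D` zero, the commutation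
      -- relation leaves only the contribution of `C`, which is the entry wanted.
      · have := key (.inl (.inl i)) (.inl (.inr j)) (h₅ _ _)
        have hd : D (.inl (.inl i)) (.inl (.inr j)) = 0 := by
          by_contra h0
          exact h₆ _ _ (hD _ _ h0).1
        rw [hv, Matrix.mul_diagonal, Matrix.diagonal_mul, hd] at this
        simpa [C₁, eq_comm] using this
      · simpa using s₂ i j
    · rcases j with j | j
      · simpa using s₁ i j
      · rw [z, Matrix.diagonal_apply, Matrix.diagonal_apply]
        simp [π']

/-- Dual situation: the radical component is the projection of `κ ⊕ γ` onto `γ`. Its stabiliser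
preserves the kernel `κ` and acts equally on both copies of `γ`; the entries of type (κ, γ) inside
the first block become the radical between `κ` and `γ` in the algebra of `S`. -/
theorem of_removeSurjective {κ γ δ : Type} [Fintype κ] [DecidableEq κ] [Fintype γ] [DecidableEq γ]
    [Fintype δ] [DecidableEq δ] {S : κ ⊕ (γ ⊕ δ) → κ ⊕ (γ ⊕ δ) → Prop} {d : ℕ}
    {R : (κ ⊕ γ) ⊕ (γ ⊕ δ) → (κ ⊕ γ) ⊕ (γ ⊕ δ) → Prop}
    (h₁ : ∀ i j, R (.inl i) (.inl j)) (h₂ : ∀ i j, R (.inl i) (.inr (.inl j)))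
    (h₃ : ∀ i j, ¬ R (.inl i) (.inr (.inr j))) (h₄ : ∀ i j, ¬ R (.inr i) (.inl j))
    (h₅ : ∀ i j, S (.inl i) (.inl j)) (h₆ : ∀ i j, S (.inl i) (.inr (.inl j)))
    (h₇ : ∀ i j, ¬ S (.inl i) (.inr (.inr j))) (h₈ : ∀ i j, ¬ S (.inr i) (.inl j))
    (h₉ : ∀ i j, R (.inr i) (.inr j) ↔ S (.inr i) (.inr j))
    (h : HasDiagonalForm S d) : HasDiagonalForm R d := by
  obtain ⟨G, π, hπ, hG, hx⟩ := h
  have g₁ : ∀ i j, G (.inl i) (.inr j) = 0 := fun i j => by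
    by_contra h0
    exact h₈ _ _ (hG _ _ h0).1
  have g₂ : ∀ i j, G (.inr (.inr i)) (.inl j) = 0 := fun i j => by
    by_contra h0
    exact h₇ _ _ (hG _ _ h0).1
  let σ : κ ⊕ γ → κ ⊕ (γ ⊕ δ) := Sum.elim .inl (fun g => .inr (.inl g))
  let A : Matrix (κ ⊕ γ) (κ ⊕ γ) ℂ := Matrix.of fun i j => Sum.elim (fun k => G (σ i) (.inl k)) 0 j
  let C : Matrix (γ ⊕ δ) (κ ⊕ γ) ℂ :=
    Matrix.of fun i j => if j.map id Sum.inl = Sum.inr i then 1 else 0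
  have A₁ : ∀ i j, A i (.inl j) = G (σ i) (.inl j) := fun _ _ => rfl
  have A₂ : ∀ i j, A i (.inr j) = 0 := fun _ _ => rfl
  have C₁ : ∀ i k, C i (.inl k) = 0 := fun i k => by simp [C]
  have C₂ : ∀ i k, C (.inl i) (.inr k) = if k = i then 1 else 0 := fun i k => by simp [C]
  have C₃ : ∀ i k, C (.inr i) k = 0 := fun i k => by rcases k with k | k <;> simp [C]
  let π' : (κ ⊕ γ) ⊕ (γ ⊕ δ) → Fin d := Sum.elim (π ∘ σ) (fun i => π (.inr i))
  refine ⟨Matrix.fromBlocks A 0 C G.toBlocks₂₂, π', fun k => ?_, ?_, ?_⟩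
  · obtain ⟨a | a, ha⟩ := hπ k
    · exact ⟨.inl (.inl a), ha⟩
    · exact ⟨.inr a, ha⟩
  · rintro (i | i) (j | j) hij
    · refine ⟨h₁ _ _, ?_⟩
      rcases j with j | j
      · exact (hG _ _ hij).2
      · exact absurd (A₂ i j) hij
    · exact absurd rfl hij
    · rcases i with i | i
      · refine ⟨h₂ _ _, ?_⟩
        rcases j with j | j
        · exact absurd (C₁ (.inl i) j) hij
        · have : j = i := by
            by_contra h0
            exact hij ((C₂ i j).trans (if_neg h0))
          subst this
          rfl
      · exact absurd (C₃ i j) hij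
    · exact ⟨(h₉ _ _).2 (hG _ _ hij).1, (hG _ _ hij).2⟩
  · intro x hs he
    have s₁ : ∀ i j, x (.inr i) (.inl j) = 0 := fun i j => hs _ _ (h₄ i j)
    have s₂ : ∀ i j, x (.inl i) (.inr (.inr j)) = 0 := fun i j => hs _ _ (h₃ i j)
    have x₀ : ∀ g k, x (.inl (.inr g)) (.inl (.inl k)) = 0 := fun g k => by
      simpa [Matrix.mul_apply, C₁, C₂, C₃, s₁, eq_comm] using
        he (.inr (.inl g)) (.inl (.inl k)) (h₂ _ _)
    have x₁ : ∀ g k, x (.inl (.inr g)) (.inl (.inr k)) = x (.inr (.inl g)) (.inr (.inl k)) :=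
      fun g k => by
        simpa [Matrix.mul_apply, C₁, C₂, C₃, s₁, eq_comm] using
          he (.inr (.inl g)) (.inl (.inr k)) (h₂ _ _)
    -- The original radical entries are determined by the (κ, γ) entries, so they vanish once those
    -- do.
    have y₀ : ∀ i g, x (.inl i) (.inr (.inl g)) =
        ∑ k, G (σ i) (.inl k) * x (.inl (.inl k)) (.inl (.inr g)) := fun i g => by
      simpa [Matrix.mul_apply, C₁, C₂, C₃, A₁, A₂, s₁] using he (.inl i) (.inl (.inr g)) (h₁ _ _)
    -- The element of the smaller algebra obtained by reading the (κ, γ) part of the first block as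
    -- radical.
    let x' : Matrix (κ ⊕ (γ ⊕ δ)) (κ ⊕ (γ ⊕ δ)) ℂ := Matrix.fromBlocks
      (Matrix.of fun i j => x (.inl (.inl i)) (.inl (.inl j)))
      (Matrix.of fun i => Sum.elim (fun g => x (.inl (.inl i)) (.inl (.inr g))) 0) 0 x.toBlocks₂₂
    have e₁ : ∀ i j, x' (.inl i) (.inl j) = x (.inl (.inl i)) (.inl (.inl j)) := fun _ _ => rfl
    have e₂ : ∀ i g, x' (.inl i) (.inr (.inl g)) = x (.inl (.inl i)) (.inl (.inr g)) :=
      fun _ _ => rfl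
    have e₃ : ∀ i j, x' (.inl i) (.inr (.inr j)) = 0 := fun _ _ => rfl
    have e₄ : ∀ i j, x' (.inr i) (.inl j) = 0 := fun _ _ => rfl
    have e₅ : ∀ i j, x' (.inr i) (.inr j) = x (.inr i) (.inr j) := fun _ _ => rfl
    obtain ⟨v, hv⟩ := hx x' (by
        rintro (i | i) (j | j | j) hij
        · exact absurd (h₅ _ _) hij
        · exact absurd (h₆ _ _) hij
        · rfl
        · rfl
        all_goals exact hs _ _ (by rwa [h₉]))
      (by
        rintro (i | i | i) (j | j) hij
        · have := he (.inl (.inl i)) (.inl (.inl j)) (h₁ _ _)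
          simpa [Matrix.mul_apply, C₁, C₂, C₃, A₁, A₂, s₁, s₂, e₁, e₂, e₃, e₄, e₅, g₂, σ, y₀]
            using this
        · exact absurd hij (h₈ _ _)
        · have := he (.inl (.inr i)) (.inl (.inl j)) (h₁ _ _)
          simpa [Matrix.mul_apply, C₁, C₂, C₃, A₁, A₂, s₁, s₂, e₁, e₂, e₃, e₄, e₅, g₂, σ, x₀, x₁]
            using this
        · have := he (.inr (.inl i)) (.inr j) ((h₉ _ _).2 hij)
          rcases j with j | j
          · simpa [Matrix.mul_apply, Matrix.toBlocks₂₂, C₁, C₂, C₃, A₁, A₂, s₁, s₂, e₁, e₂, e₃,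
              e₄, e₅, g₁, g₂, σ, y₀] using this
          · simpa [Matrix.mul_apply, Matrix.toBlocks₂₂, C₁, C₂, C₃, A₁, A₂, s₁, s₂, e₁, e₂, e₃,
              e₄, e₅, g₁, g₂, σ, y₀] using this
        · exact absurd hij (h₇ _ _)
        · have := he (.inr (.inr i)) (.inr j) ((h₉ _ _).2 hij)
          simpa [Matrix.mul_apply, Matrix.toBlocks₂₂, C₁, C₂, C₃, A₁, A₂, s₁, s₂, e₁, e₂, e₃,
            e₄, e₅, g₁, g₂, σ, y₀] using this)
    have z : ∀ a b, x' a b = Matrix.diagonal (v ∘ π) a b := fun a b => congrFun (congrFun hv a) b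
    have x₂ : ∀ k g, x (.inl (.inl k)) (.inl (.inr g)) = 0 := fun k g => by
      rw [← e₂, z, Matrix.diagonal_apply_ne _ (by simp)]
    refine ⟨v, ?_⟩
    ext i j
    rcases i with i | i
    · rcases j with j | j | j
      · rcases i with i | i <;> rcases j with j | j
        · rw [← e₁, z, Matrix.diagonal_apply, Matrix.diagonal_apply]
          simp [π', σ]
        · simpa using x₂ i j
        · simpa using x₀ i j
        · rw [x₁, ← e₅, z, Matrix.diagonal_apply, Matrix.diagonal_apply]
          simp [π', σ]
      · simp [y₀, x₂]
      · simpa using s₂ i j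
    · rcases j with j | j
      · simpa using s₁ i j
      · rw [← e₅, z, Matrix.diagonal_apply, Matrix.diagonal_apply]
        simp [π', σ]

end HasDiagonalForm

/-! ### Chains, forks and Euclid's algorithm. -/

namespace HasDiagonalForm

/-- `HasDiagonalForm` depends on a relation pulled back from `κ` only through the cardinalities of
the fibres. -/
theorem of_card_fiber {κ ι ι' : Type} [DecidableEq κ] [Fintype ι] [DecidableEq ι] [Fintype ι']
    [DecidableEq ι'] {S : κ → κ → Prop} {f : ι → κ} {f' : ι' → κ} {d : ℕ}
    (hc : ∀ k, Fintype.card {i // f' i = k} = Fintype.card {i // f i = k})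
    (h : HasDiagonalForm (fun i j => S (f i) (f j)) d) :
    HasDiagonalForm (fun i j => S (f' i) (f' j)) d := by
  let e : ι' ≃ ι := Equiv.ofFiberEquiv fun k => Fintype.equivOfCardEq (hc k)
  have he : ∀ i, f (e i) = f' i := fun i => Equiv.ofFiberEquiv_map _ i
  exact h.reindex e fun i j => by rw [he, he]

end HasDiagonalForm

/-- The map to `Fin 3` whose fibres are the three summands. -/
def summandIndex (a b c : ℕ) : Fin a ⊕ (Fin b ⊕ Fin c) → Fin 3 :=
  Sum.elim (fun _ => 0) (Sum.elim (fun _ => 1) fun _ => 2)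

theorem card_summandIndex_fiber (a b c : ℕ) (k : Fin 3) :
    Fintype.card {i // summandIndex a b c i = k} = ![a, b, c] k := by
  rw [Fintype.card_subtype, Finset.card_filter, Fintype.sum_sum_type, Fintype.sum_sum_type]
  fin_cases k <;> simp [summandIndex]

/-- The partial order on `Fin 3` in which `0` is the least element and `1`, `2` are incomparable. -/
def forkRel (i j : Fin 3) : Prop := i = j ∨ i = 0

/-- The algebra of block upper triangular matrices with blocks of sizes `a`, `b`, `c` has a form
with diagonal `d`-dimensional stabiliser. -/
def ChainForm (a b c d : ℕ) : Prop :=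
  HasDiagonalForm (fun i j => summandIndex a b c i ≤ summandIndex a b c j) d

/-- The algebra of block matrices attached to `forkRel` with blocks of sizes `a`, `b`, `c` has a
form with diagonal `d`-dimensional stabiliser. -/
def ForkForm (a b c d : ℕ) : Prop :=
  HasDiagonalForm (fun i j => forkRel (summandIndex a b c i) (summandIndex a b c j)) d

theorem ChainForm.of_card_fiber {ι : Type} [Fintype ι] [DecidableEq ι] {f : ι → Fin 3}
    {a b c d : ℕ} (h : ChainForm a b c d)
    (hf : ∀ k, ∑ i, (if f i = k then 1 else 0) = ![a, b, c] k) :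
    HasDiagonalForm (fun i j => f i ≤ f j) d :=
  HasDiagonalForm.of_card_fiber (S := (· ≤ ·)) (f := summandIndex a b c)
    (fun k => by
      rw [card_summandIndex_fiber, ← hf, Fintype.card_subtype, Finset.card_filter]) h

theorem ChainForm.mk_of_card_fiber {ι : Type} [Fintype ι] [DecidableEq ι] {f : ι → Fin 3}
    {a b c d : ℕ} (hf : ∀ k, ∑ i, (if f i = k then 1 else 0) = ![a, b, c] k)
    (h : HasDiagonalForm (fun i j => f i ≤ f j) d) : ChainForm a b c d :=
  HasDiagonalForm.of_card_fiber (S := (· ≤ ·)) (f := f)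
    (fun k => by
      rw [card_summandIndex_fiber, ← hf, Fintype.card_subtype, Finset.card_filter]) h

theorem ForkForm.of_card_fiber {ι : Type} [Fintype ι] [DecidableEq ι] {f : ι → Fin 3}
    {a b c d : ℕ} (h : ForkForm a b c d)
    (hf : ∀ k, ∑ i, (if f i = k then 1 else 0) = ![a, b, c] k) :
    HasDiagonalForm (fun i j => forkRel (f i) (f j)) d :=
  HasDiagonalForm.of_card_fiber (f := summandIndex a b c)
    (fun k => by
      rw [card_summandIndex_fiber, ← hf, Fintype.card_subtype, Finset.card_filter]) h

theorem ForkForm.mk_of_card_fiber {ι : Type} [Fintype ι] [DecidableEq ι] {f : ι → Fin 3}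
    {a b c d : ℕ} (hf : ∀ k, ∑ i, (if f i = k then 1 else 0) = ![a, b, c] k)
    (h : HasDiagonalForm (fun i j => forkRel (f i) (f j)) d) : ForkForm a b c d :=
  HasDiagonalForm.of_card_fiber (f := f) (fun k => by
      rw [card_summandIndex_fiber, ← hf, Fintype.card_subtype, Finset.card_filter]) h

theorem ChainForm.reverse {a b c d : ℕ} (h : ChainForm a b c d) : ChainForm c b a d := by
  have := HasDiagonalForm.transpose h
  refine ChainForm.mk_of_card_fiber (f := fun i => (summandIndex a b c i).rev) (fun k => ?_)
    (by simpa only [Fin.rev_le_rev] using this)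
  rw [Fintype.sum_sum_type, Fintype.sum_sum_type]
  fin_cases k <;> simp [summandIndex]

theorem ForkForm.swap {a b c d : ℕ} (h : ForkForm a b c d) : ForkForm a c b d := by
  have h0 : Equiv.swap (1 : Fin 3) 2 0 = 0 := by decide
  refine ForkForm.mk_of_card_fiber (f := fun i => Equiv.swap 1 2 (summandIndex a b c i))
    (fun k => ?_) ?_
  · rw [Fintype.sum_sum_type, Fintype.sum_sum_type]
    fin_cases k <;> simp [summandIndex, h0]
  · have : ∀ i j, forkRel (Equiv.swap 1 2 i) (Equiv.swap 1 2 j) ↔ forkRel i j := fun i j => by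
      simp [forkRel, Equiv.swap_apply_eq_iff, h0]
    simp only [this]
    exact h

theorem ForkForm.of_zero_left (b c : ℕ) : ForkForm 0 b c (b + c) := by
  have := HasDiagonalForm.of_symmetric
    (R := fun i j => forkRel (summandIndex 0 b c i) (summandIndex 0 b c j)) (fun i => .inl rfl)
    (by
      rintro (i | i | i) (j | j | j) <;> try exact i.elim0
      all_goals try exact j.elim0
      all_goals simp [summandIndex, forkRel])
  simpa [ForkForm] using this

theorem ForkForm.of_zero_right (a : ℕ) : ForkForm a 0 0 a := by
  have := HasDiagonalForm.of_symmetric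
    (R := fun i j => forkRel (summandIndex a 0 0 i) (summandIndex a 0 0 j)) (fun i => .inl rfl)
    (by
      rintro (i | i | i) (j | j | j) <;> first | exact i.elim0 | exact j.elim0 | skip
      simp [summandIndex, forkRel])
  simpa [ForkForm] using this

theorem ChainForm.of_zero_right (a : ℕ) : ChainForm a 0 0 a := by
  have := HasDiagonalForm.of_symmetric
    (R := fun i j => summandIndex a 0 0 i ≤ summandIndex a 0 0 j) (fun i => le_rfl)
    (by
      rintro (i | i | i) (j | j | j) <;> first | exact i.elim0 | exact j.elim0 | skip
      simp [summandIndex])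
  simpa [ChainForm] using this

theorem ChainForm.of_zero_sides (b : ℕ) : ChainForm 0 b 0 b := by
  have := HasDiagonalForm.of_symmetric
    (R := fun i j => summandIndex 0 b 0 i ≤ summandIndex 0 b 0 j) (fun i => le_rfl)
    (by
      rintro (i | i | i) (j | j | j) <;> first | exact i.elim0 | exact j.elim0 | skip
      simp [summandIndex])
  simpa [ChainForm] using this

/-- Surjection of the first block onto the other two together, with kernel of dimension `k`. -/
theorem ChainForm.add_left {k b c d : ℕ} (h : ChainForm k b c d) :
    ChainForm (k + (b + c)) b c d := by
  let g : Fin b ⊕ Fin c → Fin 3 := Sum.elim (fun _ => 1) fun _ => 2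
  have h' := h.of_card_fiber
    (f := (Sum.elim (fun _ => 0) (Sum.elim g Fin.elim0) : Fin k ⊕ (_ ⊕ Fin 0) → Fin 3))
    (fun x => by
      simp only [Fintype.sum_sum_type]
      fin_cases x <;> simp [g])
  refine ChainForm.mk_of_card_fiber
    (f := (Sum.elim (fun _ => 0) (Sum.elim g Fin.elim0) : (Fin k ⊕ _) ⊕ (_ ⊕ Fin 0) → Fin 3))
    (fun x => ?_) (h'.of_removeSurjective ?_ ?_ ?_ ?_ ?_ ?_ ?_ ?_ ?_)
  · simp only [Fintype.sum_sum_type]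
    fin_cases x <;> simp [g]
  all_goals simp [g]

/-- A generic subspace of dimension i + q meets the flag subspace of dimension p + i, inside
dimension p + i + q, in dimension `i`. Preserving both subspaces leaves the fork with parts `i`,
`p`, `q`. -/
theorem ForkForm.chain_add {i p q d : ℕ} (h : ForkForm i p q d) :
    ChainForm (i + q) (p + i) q d := by
  have h' := h.of_card_fiber (f := (Sum.elim (Sum.elim (Sum.elim (fun _ => 0) fun _ => 2) fun _ => 1)
    Fin.elim0 : ((Fin i ⊕ Fin q) ⊕ Fin p) ⊕ Fin 0 → Fin 3)) (fun x => by
      simp only [Fintype.sum_sum_type]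
      fin_cases x <;> simp)
  refine ChainForm.mk_of_card_fiber (f := (Sum.elim (fun _ => 0) (Sum.elim (Sum.elim
    (Sum.elim (fun _ => 1) fun _ => 2) fun _ => 1) Fin.elim0) :
      _ ⊕ (((Fin i ⊕ Fin q) ⊕ Fin p) ⊕ Fin 0) → Fin 3))
    (fun x => ?_) (h'.of_removeInjective ?_ ?_ ?_ ?_ ?_ ?_ ?_)
  · simp only [Fintype.sum_sum_type]
    fin_cases x <;> simp [add_comm]
  all_goals simp [forkRel]

/-- After transposition: surjection of the middle block onto the least one, with kernel of dimension
`p`. -/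
theorem ForkForm.add_middle {i p q d : ℕ} (h : ForkForm i p q d) : ForkForm i (p + i) q d := by
  have h' := (h.of_card_fiber (f := (Sum.elim (fun _ => 1) (Sum.elim (fun _ => 0) fun _ => 2) :
    Fin p ⊕ (Fin i ⊕ Fin q) → Fin 3)) (fun x => by
      simp only [Fintype.sum_sum_type]
      fin_cases x <;> simp)).transpose
  refine ForkForm.mk_of_card_fiber
    (f := (Sum.elim (fun _ => 1) (Sum.elim (fun _ => 0) fun _ => 2) :
      (Fin p ⊕ Fin i) ⊕ (Fin i ⊕ Fin q) → Fin 3))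
    (fun x => ?_) (h'.of_removeSurjective ?_ ?_ ?_ ?_ ?_ ?_ ?_ ?_ ?_).transpose
  · simp only [Fintype.sum_sum_type]
    fin_cases x <;> simp
  all_goals simp [forkRel]

/-- After transposition: injection of the middle block into the least one. Its image splits that
block in two, turning the fork into a chain. -/
theorem ChainForm.fork {k p q d : ℕ} (h : ChainForm k p q d) : ForkForm (k + p) p q d := by
  have h' := (h.of_card_fiber (f := (Sum.elim (Sum.elim (fun _ => 1) fun _ => 0) fun _ => 2 :
    (Fin p ⊕ Fin k) ⊕ Fin q → Fin 3)) (fun x => by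
      simp only [Fintype.sum_sum_type]
      fin_cases x <;> simp)).transpose
  refine ForkForm.mk_of_card_fiber
    (f := (Sum.elim (fun _ => 1) (Sum.elim (fun _ => 0) fun _ => 2) :
      Fin p ⊕ ((Fin p ⊕ Fin k) ⊕ Fin q) → Fin 3))
    (fun x => ?_) (h'.of_removeInjective ?_ ?_ ?_ ?_ ?_ ?_ ?_).transpose
  · simp only [Fintype.sum_sum_type]
    fin_cases x <;> simp [add_comm]
  all_goals simp [forkRel]

/-- Euclid's algorithm on both families at once, by induction on total size. Reversing chains and
swapping fork branches gives the inequalities each subtraction needs. -/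
theorem chainForm_and_forkForm_gcd (N : ℕ) :
    (∀ a b c, a + b + c = N → ChainForm a b c (Nat.gcd (a + b) (b + c))) ∧
      ∀ i p q, i + p + q = N → ForkForm i p q (Nat.gcd i (p + q)) := by
  induction N using Nat.strong_induction_on with
  | _ N ih =>
    have hC : ∀ a b c, a + b + c = N → c ≤ a → ChainForm a b c (Nat.gcd (a + b) (b + c)) := by
      intro a b c hN hca
      rcases Nat.eq_zero_or_pos a with rfl | ha
      · obtain rfl : c = 0 := by omega
        simpa using ChainForm.of_zero_sides b
      rcases le_or_gt (b + c) a with h | h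
      · rcases Nat.eq_zero_or_pos (b + c) with h0 | h0
        · obtain ⟨rfl, rfl⟩ : b = 0 ∧ c = 0 := by omega
          simpa using ChainForm.of_zero_right a
        obtain ⟨k, rfl⟩ := Nat.exists_eq_add_of_le' h
        have := ((ih (k + b + c) (by omega)).1 k b c rfl).add_left
        rwa [show k + (b + c) + b = (k + b) + (b + c) by omega, Nat.gcd_add_self_left]
      · obtain ⟨i, rfl⟩ := Nat.exists_eq_add_of_le' hca
        obtain ⟨p, rfl⟩ : ∃ p, b = p + i := ⟨b - i, by omega⟩
        have := ((ih (i + p + c) (by omega)).2 i p c rfl).chain_add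
        rwa [show i + c + (p + i) = i + (p + i + c) by omega, Nat.gcd_add_self_left,
          show p + i + c = p + c + i by omega, Nat.gcd_add_self_right]
    have hL : ∀ i p q, i + p + q = N → 0 < i → 0 < p → ForkForm i p q (Nat.gcd i (p + q)) := by
      intro i p q hN hi hp
      rcases le_or_gt i p with h | h
      · obtain ⟨p, rfl⟩ := Nat.exists_eq_add_of_le' h
        have := ((ih (i + p + q) (by omega)).2 i p q rfl).add_middle
        rwa [show p + i + q = p + q + i by omega, Nat.gcd_add_self_right]
      · obtain ⟨k, rfl⟩ := Nat.exists_eq_add_of_le' h.le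
        exact ((ih (k + p + q) (by omega)).1 k p q rfl).fork
    refine ⟨fun a b c hN => ?_, fun i p q hN => ?_⟩
    · rcases le_total c a with h | h
      · exact hC a b c hN h
      · have := (hC c b a (by omega) h).reverse
        rwa [Nat.gcd_comm, add_comm b, add_comm c] at this
    · rcases Nat.eq_zero_or_pos i with rfl | hi
      · simpa using ForkForm.of_zero_left p q
      rcases Nat.eq_zero_or_pos p with rfl | hp
      · rcases Nat.eq_zero_or_pos q with rfl | hq
        · simpa using ForkForm.of_zero_right i
        · rw [add_comm 0]
          exact (hL i q 0 (by omega) hi hq).swap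
      · exact hL i p q hN hi hp

/-! ### Semicontinuity and invariance of stabiliser dimensions. -/

section Stabilizer

variable {K L : Type*} [Field K] [LieRing L] [LieAlgebra K L]

theorem mem_coadjointStabilizer {f : Module.Dual K L} {x : L} :
    x ∈ coadjointStabilizer f ↔ ∀ y : L, f ⁅x, y⁆ = 0 :=
  Iff.rfl

theorem coadjointStabilizer_smul {t : K} (ht : t ≠ 0) (f : Module.Dual K L) :
    coadjointStabilizer (t • f) = coadjointStabilizer f := by
  ext x
  simp [mem_coadjointStabilizer, ht]

/-- On a complement `U` of `ker M`, `M` has a left inverse `g`. If `M + t • N` kills a nonzero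
vector of `U` and t ≠ 0, then -1/t is an eigenvalue of `g ∘ N` on `U`, so only finitely many `t`
occur. Otherwise the kernel is disjoint from `U` and no larger than `ker M`. -/
theorem LinearMap.finite_finrank_ker_lt_finrank_ker_add_smul {V W : Type*} [AddCommGroup V]
    [Module K V] [FiniteDimensional K V] [AddCommGroup W] [Module K W] (M N : V →ₗ[K] W) :
    {t : K | Module.finrank K (LinearMap.ker M) <
      Module.finrank K (LinearMap.ker (M + t • N))}.Finite := by
  obtain ⟨U, hU⟩ := Submodule.exists_isCompl (LinearMap.ker M)
  have hinj : LinearMap.ker (M ∘ₗ U.subtype) = ⊥ := by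
    rw [LinearMap.ker_eq_bot']
    intro u hu
    have : (u : V) ∈ LinearMap.ker M ⊓ U := ⟨hu, u.2⟩
    rw [hU.inf_eq_bot] at this
    exact Subtype.ext this
  obtain ⟨g, hg⟩ := LinearMap.exists_leftInverse_of_injective _ hinj
  let E : Module.End K U := g ∘ₗ N ∘ₗ U.subtype
  refine ((E.finite_hasEigenvalue.image fun μ => -μ⁻¹).insert 0).subset fun t ht => ?_
  by_contra hcon
  rw [Set.mem_insert_iff, not_or] at hcon
  obtain ⟨ht0, hte⟩ := hcon
  have hdisj : Disjoint (LinearMap.ker (M + t • N)) U := by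
    rw [Submodule.disjoint_def]
    intro u hu huU
    by_contra hu0
    refine hte ⟨-t⁻¹, ?_, by simp⟩
    refine Module.End.hasEigenvalue_of_hasEigenvector (x := ⟨u, huU⟩) ⟨?_, fun h0 => hu0 ?_⟩
    · rw [Module.End.mem_eigenspace_iff]
      have h1 : g (M u) = ⟨u, huU⟩ := LinearMap.congr_fun hg ⟨u, huU⟩
      have h2 : g (M u) + t • E ⟨u, huU⟩ = 0 := by
        have : (M + t • N) u = 0 := hu
        rw [LinearMap.add_apply, LinearMap.smul_apply] at this
        rw [← map_zero g, ← this, map_add, map_smul]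
        rfl
      rw [h1] at h2
      rw [neg_smul, eq_neg_iff_add_eq_zero, ← smul_right_injective U ht0 |>.eq_iff]
      rw [smul_add, smul_zero, smul_smul, mul_inv_cancel₀ ht0, one_smul, add_comm]
      exact h2
    · exact congrArg Subtype.val h0
  have h1 := Submodule.finrank_add_finrank_le_of_disjoint hdisj
  have h2 := Submodule.finrank_add_eq_of_isCompl hU
  have h3 : Module.finrank K (LinearMap.ker M) <
    Module.finrank K (LinearMap.ker (M + t • N)) := ht
  omega

theorem finite_finrank_coadjointStabilizer_lt_add_smul [FiniteDimensional K L]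
    (f g : Module.Dual K L) :
    {t : K | Module.finrank K (coadjointStabilizer f) <
      Module.finrank K (coadjointStabilizer (f + t • g))}.Finite := by
  let B : Module.Dual K L → L →ₗ[K] Module.Dual K L := fun f =>
    LinearMap.mk₂ K (fun x y => f ⁅x, y⁆) (by simp) (by simp) (by simp) (by simp)
  have hB : ∀ f, coadjointStabilizer f = LinearMap.ker (B f) := fun f => by
    ext x
    rw [mem_coadjointStabilizer, LinearMap.mem_ker, LinearMap.ext_iff]
    rfl
  have hadd : ∀ t : K, B (f + t • g) = B f + t • B g := fun t => by
    ext x y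
    simp [B]
  have hf : ∀ f, Module.finrank K (coadjointStabilizer f) =
    Module.finrank K (LinearMap.ker (B f)) := fun f => by rw [hB]
  have hf' : ∀ t : K, Module.finrank K (LinearMap.ker (B (f + t • g))) =
    Module.finrank K (LinearMap.ker (B f + t • B g)) := fun t => by rw [hadd]
  simpa only [hf, hf'] using
    LinearMap.finite_finrank_ker_lt_finrank_ker_add_smul (B f) (B g)

theorem lieIndex_congr {L' : Type*} [LieRing L'] [LieAlgebra K L'] (e : L ≃ₗ⁅K⁆ L') :
    lieIndex K L = lieIndex K L' := by
  unfold lieIndex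
  congr 1
  have key : ∀ f : Module.Dual K L', Module.finrank K (coadjointStabilizer f) =
      Module.finrank K (coadjointStabilizer (f ∘ₗ e.toLinearEquiv.toLinearMap)) := fun f => by
    have : coadjointStabilizer f = (coadjointStabilizer
        (f ∘ₗ e.toLinearEquiv.toLinearMap)).map e.toLinearEquiv.toLinearMap := by
      ext x
      rw [Submodule.mem_map_equiv, mem_coadjointStabilizer, mem_coadjointStabilizer]
      have he : ∀ y, e ⁅e.symm x, y⁆ = ⁅x, e y⁆ := fun y => by
        rw [LieEquiv.map_lie, LieEquiv.apply_symm_apply]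
      refine ⟨fun h y => (congrArg f (he y)).trans (h _), fun h y => ?_⟩
      rw [← e.apply_symm_apply y, ← he]
      exact h _
    rw [this]
    exact LinearEquiv.finrank_map_eq _ _
  ext k
  constructor
  · rintro ⟨f, rfl⟩
    refine ⟨f ∘ₗ e.symm.toLinearEquiv.toLinearMap, ?_⟩
    have : (f ∘ₗ e.symm.toLinearEquiv.toLinearMap) ∘ₗ e.toLinearEquiv.toLinearMap = f :=
      LinearMap.ext fun x => congrArg f (e.symm_apply_apply x)
    exact (key _).trans (by rw [this])
  · rintro ⟨f, rfl⟩
    exact ⟨_, (key f).symm⟩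

end Stabilizer

/-! ### Trace duality and the local slice. -/

section Trace

variable {ι : Type} [Fintype ι]

theorem Matrix.trace_mul_eq_zero_of_support {R : ι → ι → Prop} {M x : Matrix ι ι ℂ}
    (hM : ∀ i j, R j i → M i j = 0) (hx : ∀ i j, ¬ R i j → x i j = 0) : (M * x).trace = 0 := by
  rw [Matrix.trace]
  refine Finset.sum_eq_zero fun i _ => ?_
  rw [Matrix.diag_apply, Matrix.mul_apply]
  refine Finset.sum_eq_zero fun j _ => ?_
  by_cases h : R j i
  · rw [hM i j h, zero_mul]
  · rw [hx j i h, mul_zero]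

theorem Matrix.exists_dual_eq_trace_mul [DecidableEq ι] (φ : Module.Dual ℂ (Matrix ι ι ℂ)) :
    ∃ p : Matrix ι ι ℂ, ∀ M, φ M = (p * M).trace := by
  refine ⟨Matrix.of fun i j => φ (Matrix.single j i 1), fun M => ?_⟩
  have h : ∀ i j, φ (Matrix.single i j (M i j)) = M i j * φ (Matrix.single i j 1) := fun i j => by
    rw [← smul_eq_mul, ← map_smul, Matrix.smul_single, smul_eq_mul, mul_one]
  simp only [Matrix.trace, Matrix.diag_apply, Matrix.mul_apply, Matrix.of_apply]
  rw [Finset.sum_comm]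
  conv_lhs => rw [Matrix.matrix_eq_sum_single M]
  simp only [map_sum, h, mul_comm]

end Trace

open Filter Topology in
/-- If the tangent vectors `a x - x a + y`, with `x ∈ A` and `y ∈ Y`, exhaust the algebra, then all
elements close to `a` are conjugate to elements of `a + Y` by units in `1 + A`. -/
theorem eventually_exists_unit_conj {R : Type*} [NormedRing R] [NormedAlgebra ℂ R]
    [FiniteDimensional ℂ R] (A Y : Submodule ℂ R) (a : R)
    (h : ∀ m, ∃ x ∈ A, ∃ y ∈ Y, a * x - x * a + y = m) (m : R) :
    ∀ᶠ t in 𝓝 (0 : ℂ), ∃ u : Rˣ, (u : R) - 1 ∈ A ∧ ∃ y ∈ Y, a + t • m = ↑u⁻¹ * (a + y) * u := by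
  have : CompleteSpace R := FiniteDimensional.complete ℂ R
  have : CompleteSpace (A × Y) := FiniteDimensional.complete ℂ (A × Y)
  let i : A × Y →L[ℂ] R := A.subtypeL ∘L ContinuousLinearMap.fst ℂ A Y
  let j : A × Y →L[ℂ] R := Y.subtypeL ∘L ContinuousLinearMap.snd ℂ A Y
  have hi : HasStrictFDerivAt (fun p => 1 + i p) i 0 := i.hasStrictFDerivAt.const_add 1
  have hj : HasStrictFDerivAt (fun p => a + j p) j 0 := j.hasStrictFDerivAt.const_add a
  have hinv : HasStrictFDerivAt (fun p => Ring.inverse (1 + i p)) _ 0 :=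
    HasStrictFDerivAt.comp (f := fun p => 1 + i p) 0
      (by simpa using hasStrictFDerivAt_ringInverse (𝕜 := ℂ) (1 : Rˣ)) hi
  -- The derivative at 0 of (1 + x)⁻¹ (a + y) (1 + x) is a x - x a + y; being surjective, it makes
  -- the map open there.
  have hΦ := (hinv.mul' hj).mul' hi
  have hsurj := hΦ.map_nhds_eq_of_surj (by
    rw [LinearMap.range_eq_top]
    intro m
    obtain ⟨x, hx, y, hy, hm⟩ := h m
    refine ⟨(⟨x, hx⟩, ⟨y, hy⟩), ?_⟩
    rw [← hm]
    simp [i, j]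
    abel)
  have hcont : Tendsto (fun t : ℂ => a + t • m) (𝓝 0) (𝓝 a) := by
    have : Continuous fun t : ℂ => a + t • m := by fun_prop
    simpa using this.tendsto 0
  have hunit : ∀ᶠ p in 𝓝 (0 : A × Y), IsUnit (1 + i p) := by
    have : Tendsto (fun p => 1 + i p) (𝓝 0) (𝓝 1) := by
      simpa using hi.continuousAt.tendsto
    exact this.eventually (Units.isOpen.mem_nhds isUnit_one)
  have himage := image_mem_map (m := fun p => Ring.inverse (1 + i p) * (a + j p) * (1 + i p)) hunit
  have h0 : Ring.inverse (1 + i 0) * (a + j 0) * (1 + i 0) = a := by simp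
  have hmem : _ ∈ 𝓝 a := (hsurj.trans (congrArg 𝓝 h0)) ▸ himage
  filter_upwards [hcont.eventually hmem] with t ht
  obtain ⟨p, ⟨u, hu⟩, hp⟩ := ht
  refine ⟨u, ?_, j p, p.2.2, ?_⟩
  · rw [hu, add_sub_cancel_left]
    exact p.1.2
  · rw [← hp]
    rw [← hu, Ring.inverse_unit]

/-! ### The index of a parabolic subalgebra. -/

section Parabolic

variable {n : ℕ} {c : Composition n}

theorem mem_standardParabolic {M : Matrix (Fin n) (Fin n) ℂ} :
    M ∈ standardParabolic c ↔ ∀ i j, ¬ c.index i ≤ c.index j → M i j = 0 := by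
  simp only [not_le]
  exact Iff.rfl

/-- The linear form `x ↦ tr (F x)` on a standard parabolic subalgebra. -/
noncomputable def traceDual (c : Composition n) :
    Matrix (Fin n) (Fin n) ℂ →ₗ[ℂ] Module.Dual ℂ (standardParabolic c) :=
  LinearMap.mk₂ ℂ (fun F x => (F * (x : Matrix (Fin n) (Fin n) ℂ)).trace)
    (by simp [add_mul]) (by simp) (by simp [mul_add]) (by simp)

theorem traceDual_apply (F : Matrix (Fin n) (Fin n) ℂ) (x : standardParabolic c) :
    traceDual c F x = (F * (x : Matrix (Fin n) (Fin n) ℂ)).trace :=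
  rfl

theorem traceDual_surjective : Function.Surjective (traceDual c) := by
  intro f
  obtain ⟨φ, hφ⟩ := LinearMap.exists_extend (p := (standardParabolic c).toSubmodule) f
  obtain ⟨F, hF⟩ := Matrix.exists_dual_eq_trace_mul φ
  refine ⟨F, LinearMap.ext fun x => ?_⟩
  rw [traceDual_apply, ← hF]
  exact LinearMap.congr_fun hφ x

theorem traceDual_lie (F : Matrix (Fin n) (Fin n) ℂ) (x y : standardParabolic c) :
    traceDual c F ⁅x, y⁆ = ((F * x - x * F) * (y : Matrix (Fin n) (Fin n) ℂ)).trace := by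
  rw [traceDual_apply, LieSubalgebra.coe_bracket, Ring.lie_def, mul_sub, sub_mul,
    Matrix.trace_sub, Matrix.trace_sub, ← mul_assoc, ← mul_assoc,
    Matrix.trace_mul_cycle F (y : Matrix (Fin n) (Fin n) ℂ)]

theorem mul_apply_eq_of_forall_trace_mul_eq_zero {x F : Matrix (Fin n) (Fin n) ℂ}
    (h : ∀ y ∈ standardParabolic c, ((F * x - x * F) * y).trace = 0) (i j : Fin n)
    (hij : c.index j ≤ c.index i) : (x * F) i j = (F * x) i j := by
  have := h (Matrix.single j i 1) (mem_standardParabolic.2 fun a b hab =>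
    Matrix.single_apply_of_ne _ _ _ _ _ (by rintro ⟨rfl, rfl⟩; exact hab hij))
  rw [Matrix.trace_mul_single, MulOpposite.op_one, one_smul, Matrix.sub_apply, sub_eq_zero] at this
  exact this.symm

theorem mul_mem_standardParabolic {M N : Matrix (Fin n) (Fin n) ℂ}
    (hM : M ∈ standardParabolic c) (hN : N ∈ standardParabolic c) :
    M * N ∈ standardParabolic c :=
  Matrix.BlockTriangular.mul (b := c.index) hM hN

theorem diagonal_mem_standardParabolic (v : Fin n → ℂ) :
    Matrix.diagonal v ∈ standardParabolic c :=
  Matrix.blockTriangular_diagonal v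

theorem inv_mem_standardParabolic (u : (Matrix (Fin n) (Fin n) ℂ)ˣ)
    (hu : (u : Matrix (Fin n) (Fin n) ℂ) ∈ standardParabolic c) :
    (↑u⁻¹ : Matrix (Fin n) (Fin n) ℂ) ∈ standardParabolic c := by
  rw [Matrix.coe_units_inv]
  have : Invertible (u : Matrix (Fin n) (Fin n) ℂ) := u.invertible
  exact Matrix.blockTriangular_inv_of_blockTriangular (b := c.index) hu

/-- If `G` has no entries linking distinct fibres of `π`, then the forms conjugate to `tr (G x)` have a
stabiliser containing a conjugate of the torus of diagonal matrices constant on these fibres. -/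
theorem le_finrank_coadjointStabilizer_of_conj {d : ℕ} {π : Fin n → Fin d}
    (hπ : Function.Surjective π) {G : Matrix (Fin n) (Fin n) ℂ}
    (hG : ∀ i j, c.index j ≤ c.index i → π i ≠ π j → G i j = 0)
    (u : (Matrix (Fin n) (Fin n) ℂ)ˣ)
    (hu : (u : Matrix (Fin n) (Fin n) ℂ) ∈ standardParabolic c) :
    d ≤ Module.finrank ℂ (coadjointStabilizer (traceDual c (u⁻¹.val * G * u.val))) := by
  have hu' := inv_mem_standardParabolic u hu
  let θ : (Fin d → ℂ) →ₗ[ℂ] standardParabolic c :=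
    { toFun v := ⟨u⁻¹.val * Matrix.diagonal (v ∘ π) * u.val, mul_mem_standardParabolic
        (mul_mem_standardParabolic hu' (diagonal_mem_standardParabolic _)) hu⟩
      map_add' v w := by
        refine Subtype.ext ?_
        have : Matrix.diagonal ((v + w) ∘ π) =
          Matrix.diagonal (v ∘ π) + Matrix.diagonal (w ∘ π) := (Matrix.diagonal_add _ _).symm
        simp only [this, mul_add, add_mul]
        rfl
      map_smul' t v := by
        refine Subtype.ext ?_
        have : Matrix.diagonal ((t • v) ∘ π) = t • Matrix.diagonal (v ∘ π) :=
          Matrix.diagonal_smul t (v ∘ π)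
        simp only [this, Matrix.mul_smul, Matrix.smul_mul]
        rfl }
  have hθ : ∀ v, (θ v : Matrix (Fin n) (Fin n) ℂ) = u⁻¹.val * Matrix.diagonal (v ∘ π) * u.val :=
    fun _ => rfl
  have hinj : Function.Injective θ := fun v w hvw => by
    have := congrArg Subtype.val hvw
    rw [hθ, hθ, Units.mul_left_inj, Units.mul_right_inj] at this
    exact hπ.injective_comp_right (Matrix.diagonal_injective this)
  have hrange : LinearMap.range θ ≤ coadjointStabilizer (traceDual c (u⁻¹.val * G * u.val)) := by
    rintro _ ⟨v, rfl⟩ y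
    rw [traceDual_lie, hθ]
    have h1 : (u⁻¹.val * G * u * (u⁻¹.val * Matrix.diagonal (v ∘ π) * u) -
        u⁻¹.val * Matrix.diagonal (v ∘ π) * u * (u⁻¹.val * G * u) : Matrix (Fin n) (Fin n) ℂ) =
        u⁻¹.val * (G * Matrix.diagonal (v ∘ π) - Matrix.diagonal (v ∘ π) * G) * u := by
      simp only [mul_sub, sub_mul, mul_assoc, Units.mul_inv_cancel_left]
    -- Cyclicity moves the conjugation onto `y`, which stays in the parabolic.
    rw [h1, mul_assoc, mul_assoc, Matrix.trace_mul_comm, mul_assoc]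
    refine Matrix.trace_mul_eq_zero_of_support (R := fun i j => c.index i ≤ c.index j)
      (fun i j hij => ?_) (mem_standardParabolic.1 (mul_mem_standardParabolic
        (mul_mem_standardParabolic hu y.2) hu'))
    rw [Matrix.sub_apply, Matrix.mul_diagonal, Matrix.diagonal_mul, Function.comp_apply,
      Function.comp_apply]
    by_cases h : π i = π j
    · rw [h, mul_comm, sub_self]
    · rw [hG i j hij h, mul_zero, zero_mul, sub_zero]
  calc d = Module.finrank ℂ (LinearMap.range θ) := by
        rw [LinearMap.finrank_range_of_inj hinj, Module.finrank_fin_fun]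
    _ ≤ _ := Submodule.finrank_mono hrange

open scoped Matrix.Norms.Operator in
open Filter Topology in
theorem lieIndex_standardParabolic_of_hasDiagonalForm {d : ℕ}
    (h : HasDiagonalForm (fun i j => c.index i ≤ c.index j) d) :
    lieIndex ℂ (standardParabolic c) = d := by
  obtain ⟨F, π, hπ, hF, hx⟩ := h
  have hdiag : ∀ x ∈ standardParabolic c,
      (∀ y ∈ standardParabolic c, ((F * x - x * F) * y).trace = 0) →
      ∃ v : Fin d → ℂ, x = Matrix.diagonal (v ∘ π) := fun x hxm hxy =>
    hx x (mem_standardParabolic.1 hxm) (mul_apply_eq_of_forall_trace_mul_eq_zero hxy)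
  let Y : Submodule ℂ (Matrix (Fin n) (Fin n) ℂ) :=
    { carrier := {y | ∀ i j, c.index j ≤ c.index i → π i ≠ π j → y i j = 0}
      zero_mem' := fun _ _ _ _ => rfl
      add_mem' := fun {y z} hy hz i j hij hp => by
        rw [Matrix.add_apply, hy i j hij hp, hz i j hij hp, add_zero]
      smul_mem' := fun t y hy i j hij hp => by
        rw [Matrix.smul_apply, hy i j hij hp, smul_zero] }
  have hFY : F ∈ Y := fun i j _ hp => by
    by_contra h0
    exact hp (hF i j h0).2
  have htan : ∀ m, ∃ x ∈ (standardParabolic c).toSubmodule, ∃ y ∈ Y, F * x - x * F + y = m := by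
    let D : Matrix (Fin n) (Fin n) ℂ →ₗ[ℂ] Matrix (Fin n) (Fin n) ℂ :=
      LinearMap.mulLeft ℂ F - LinearMap.mulRight ℂ F
    -- By duality: `Y` contains everything strictly above the blocks, so a matrix `p` orthogonal to
    -- both summands lies in the parabolic. It stabilises `F`, hence is diagonal, and orthogonality
    -- to `Y` kills its diagonal.
    have htop : (standardParabolic c).toSubmodule.map D ⊔ Y = ⊤ := by
      by_contra hne
      obtain ⟨φ, hφ, hker⟩ := Submodule.exists_le_ker_of_lt_top _ (lt_top_iff_ne_top.2 hne)
      obtain ⟨p, hp⟩ := Matrix.exists_dual_eq_trace_mul φ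
      have hpY : ∀ i j, (c.index i ≤ c.index j → π i = π j) → p i j = 0 := fun i j hij => by
        have : φ (Matrix.single j i 1) = 0 := hker (Submodule.mem_sup_right fun a b hab hπ' =>
          Matrix.single_apply_of_ne _ _ _ _ _ (by
            rintro ⟨rfl, rfl⟩
            exact hπ' (hij hab).symm))
        rwa [hp, Matrix.trace_mul_single, MulOpposite.op_one, one_smul] at this
      obtain ⟨v, hv⟩ := hdiag p
        (mem_standardParabolic.2 fun i j hij => hpY i j fun h => absurd h hij)
        (fun y hy => by
          have : φ (F * y - y * F) = 0 :=
            hker (Submodule.mem_sup_left (Submodule.mem_map_of_mem hy))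
          rw [hp, mul_sub, Matrix.trace_sub, ← mul_assoc, ← mul_assoc,
            Matrix.trace_mul_cycle p y F, ← Matrix.trace_sub, ← sub_mul] at this
          rw [← neg_sub (p * F), neg_mul, Matrix.trace_neg, this, neg_zero])
      have hp0 : p = 0 := by
        ext i j
        by_cases hij : i = j
        · exact hpY i j fun _ => congrArg π hij
        · rw [hv, Matrix.diagonal_apply_ne _ hij, Matrix.zero_apply]
      exact hφ (LinearMap.ext fun m => by rw [hp, hp0, zero_mul, Matrix.trace_zero]; rfl)
    intro m
    obtain ⟨_, ⟨x, hxA, rfl⟩, y, hy, hm⟩ := Submodule.mem_sup.1 (htop ▸ Submodule.mem_top (x := m))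
    exact ⟨x, hxA, y, hy, hm⟩
  have hone : (1 : Matrix (Fin n) (Fin n) ℂ) ∈ (standardParabolic c).toSubmodule :=
    Matrix.blockTriangular_one
  have hlower : ∀ f : Module.Dual ℂ (standardParabolic c),
      d ≤ Module.finrank ℂ (coadjointStabilizer f) := by
    intro f
    obtain ⟨m, rfl⟩ := traceDual_surjective f
    have h1 := eventually_exists_unit_conj _ Y F htan m
    have h2 : Tendsto (fun k : ℕ => ((k : ℂ) + 1)⁻¹) atTop (𝓝 0) := by
      simpa using tendsto_one_div_add_atTop_nhds_zero_nat (𝕜 := ℂ)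
    have hinj : Function.Injective fun k : ℕ => (k : ℂ) + 1 := fun a b hab => by
      simpa using hab
    have h3 := (finite_finrank_coadjointStabilizer_lt_add_smul (traceDual c m)
      (traceDual c F)).preimage hinj.injOn
    -- For large `k` the matrix `F + (k+1)⁻¹ m` is in reach of the slice, and `k + 1` avoids the
    -- finitely many parameters where the stabiliser of `m + (k+1) F` exceeds that of `m`.
    obtain ⟨k, ⟨u, hu, y, hy, hk⟩, hk'⟩ :=
      ((h2.eventually h1).and (Nat.cofinite_eq_atTop ▸ h3.compl_mem_cofinite)).exists
    have hk0 : (k : ℂ) + 1 ≠ 0 := Nat.cast_add_one_ne_zero k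
    have hu' : (u : Matrix (Fin n) (Fin n) ℂ) ∈ (standardParabolic c).toSubmodule := by
      simpa using add_mem hu hone
    have h4 := le_finrank_coadjointStabilizer_of_conj (c := c) hπ (add_mem hFY hy) u hu'
    have h5 : traceDual c m + ((k : ℂ) + 1) • traceDual c F =
        ((k : ℂ) + 1) • traceDual c (F + ((k : ℂ) + 1)⁻¹ • m) := by
      rw [map_add, map_smul, smul_add, smul_smul, mul_inv_cancel₀ hk0, one_smul, add_comm]
    have h6 : Module.finrank ℂ (coadjointStabilizer
        (traceDual c m + ((k : ℂ) + 1) • traceDual c F)) ≤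
        Module.finrank ℂ (coadjointStabilizer (traceDual c m)) := not_lt.1 hk'
    rw [h5, coadjointStabilizer_smul hk0, hk] at h6
    exact h4.trans h6
  have hupper : Module.finrank ℂ (coadjointStabilizer (traceDual c F)) ≤ d := by
    -- One diagonal entry per fibre of `π` determines an element of the stabiliser.
    let ψ : coadjointStabilizer (traceDual c F) →ₗ[ℂ] (Fin d → ℂ) :=
      LinearMap.pi fun k =>
        (Matrix.entryLinearMap ℂ ℂ (Function.surjInv hπ k) (Function.surjInv hπ k)) ∘ₗ
          (standardParabolic c).toSubmodule.subtype ∘ₗ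
            (coadjointStabilizer (traceDual c F)).subtype
    have hψ : Function.Injective ψ := by
      rw [injective_iff_map_eq_zero]
      intro x hx0
      obtain ⟨v, hv⟩ := hdiag x.1.1 x.1.2 fun y hy =>
        (traceDual_lie F x.1 ⟨y, hy⟩).symm.trans (x.2 ⟨y, hy⟩)
      have hv0 : v = 0 := by
        ext k
        have : x.1.1 (Function.surjInv hπ k) (Function.surjInv hπ k) = 0 := congrFun hx0 k
        rwa [hv, Matrix.diagonal_apply_eq, Function.comp_apply, Function.surjInv_eq hπ] at this
      refine Subtype.ext (Subtype.ext ?_)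
      rw [hv, hv0]
      exact Matrix.diagonal_zero
    simpa using LinearMap.finrank_le_finrank_of_injective hψ
  refine le_antisymm ?_ (le_csInf (Set.range_nonempty _) ?_)
  · exact (Nat.sInf_le (Set.mem_range_self _)).trans hupper
  · rintro _ ⟨f, rfl⟩
    exact hlower f

theorem IsParabolicOfType.lieIndex_eq {𝔭 : LieSubalgebra ℂ (Matrix (Fin n) (Fin n) ℂ)}
    (h : IsParabolicOfType c 𝔭) : lieIndex ℂ 𝔭 = lieIndex ℂ (standardParabolic c) := by
  obtain ⟨g, hg⟩ := h
  have hgi : ∀ M : Matrix (Fin n) (Fin n) ℂ, (g⁻¹).val * (g.val * M * (g⁻¹).val) * g.val = M :=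
    fun M => by simp only [mul_assoc, Units.inv_mul_cancel_left, Units.inv_mul, mul_one]
  have hig : ∀ M : Matrix (Fin n) (Fin n) ℂ, g.val * ((g⁻¹).val * M * g.val) * (g⁻¹).val = M :=
    fun M => by simp only [mul_assoc, Units.mul_inv_cancel_left, Units.mul_inv, mul_one]
  refine lieIndex_congr
    { toFun := fun M => ⟨(g⁻¹).val * M.1 * g.val, (hg _).1 M.2⟩
      invFun := fun M => ⟨g.val * M.1 * (g⁻¹).val, (hg _).2 (by rw [hgi]; exact M.2)⟩
      left_inv := fun M => Subtype.ext (hig _)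
      right_inv := fun M => Subtype.ext (hgi _)
      map_add' := fun M N => Subtype.ext ?_
      map_smul' := fun t M => Subtype.ext ?_
      map_lie' := fun {M N} => Subtype.ext ?_ }
  · simp [mul_add, add_mul]
  · simp
  · simp only [LieSubalgebra.coe_bracket, Ring.lie_def, mul_sub, sub_mul, mul_assoc,
      Units.mul_inv_cancel_left]

theorem lieIndex_standardParabolic_of_chainForm {a₁ a₂ a₃ d : ℕ} (hd : ChainForm a₁ a₂ a₃ d)
    (hl : c.length ≤ 3) (hb : ∀ k : Fin 3, c.blocks.getD k 0 = ![a₁, a₂, a₃] k) :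
    lieIndex ℂ (standardParabolic c) = d := by
  refine lieIndex_standardParabolic_of_hasDiagonalForm
    (hd.of_card_fiber (f := fun i => Fin.castLE hl (c.index i)) fun k => ?_)
  rw [← hb, ← c.blocksFinEquiv.sum_comp, Fintype.sum_sigma]
  have : ∀ (i : Fin c.length) (x : Fin (c.blocksFun i)), c.index (c.blocksFinEquiv ⟨i, x⟩) = i :=
    fun i x => c.index_embedding i x
  simp only [this, Finset.sum_const, Finset.card_univ, Fintype.card_fin, smul_eq_mul, mul_ite,
    mul_one, mul_zero]
  by_cases hk : (k : ℕ) < c.length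
  · rw [Finset.sum_eq_single ⟨k, hk⟩]
    · rw [if_pos (show Fin.castLE hl ⟨k, hk⟩ = k from Fin.ext rfl), List.getD_eq_getElem _ _ hk]
      rfl
    · intro b _ hbk
      refine if_neg fun h : Fin.castLE hl b = k => hbk (Fin.ext ?_)
      have := congrArg Fin.val h
      exact this
    · simp
  · rw [List.getD_eq_default _ _ (not_lt.1 hk)]
    refine Finset.sum_eq_zero fun i _ => if_neg fun h => hk ?_
    rw [← h]
    exact i.2

end Parabolic

theorem mainTheorem7 :
    (∀ a₁ a₂ : ℕ, 0 < a₁ → 0 < a₂ →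
      ∀ (c : Composition (a₁ + a₂)), c.blocks = [a₁, a₂] →
      ∀ 𝔭 : LieSubalgebra ℂ (Matrix (Fin (a₁ + a₂)) (Fin (a₁ + a₂)) ℂ),
        IsParabolicOfType c 𝔭 → lieIndex ℂ 𝔭 = Nat.gcd a₁ a₂) ∧
    (∀ a₁ a₂ a₃ : ℕ, 0 < a₁ → 0 < a₂ → 0 < a₃ →
      ∀ (c : Composition (a₁ + a₂ + a₃)), c.blocks = [a₁, a₂, a₃] →
      ∀ 𝔭 : LieSubalgebra ℂ (Matrix (Fin (a₁ + a₂ + a₃)) (Fin (a₁ + a₂ + a₃)) ℂ),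
        IsParabolicOfType c 𝔭 → lieIndex ℂ 𝔭 = Nat.gcd (a₁ + a₂) (a₂ + a₃)) := by
  constructor
  · intro a₁ a₂ _ _ c hc 𝔭 h𝔭
    -- Two blocks are a chain with empty third block: gcd(a₁ + a₂, a₂ + 0) = gcd(a₁, a₂).
    rw [h𝔭.lieIndex_eq, lieIndex_standardParabolic_of_chainForm
      ((chainForm_and_forkForm_gcd _).1 a₁ a₂ 0 rfl) (by simp [← c.blocks_length, hc])
      (fun k => by fin_cases k <;> simp [hc]), add_zero, Nat.gcd_add_self_left]
  · intro a₁ a₂ a₃ _ _ _ c hc 𝔭 h𝔭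
    exact h𝔭.lieIndex_eq.trans (lieIndex_standardParabolic_of_chainForm
      ((chainForm_and_forkForm_gcd _).1 a₁ a₂ a₃ rfl) (by simp [← c.blocks_length, hc])
      (fun k => by fin_cases k <;> simp [hc]))
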